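/- Let $p=(p_x)_{x\in\mathbb N}$, $\mathbb N=\{0,1,2,\dots\}$, be a nonincreasing probability mass function and let $X_1,X_2,\dots$ be i.i.d. $\mathbb N$-valued random variables with mass function $p$. For a vector $w=(w_0,\dots,w_k)$ let $\mathrm{rear}(w)$ be the vector of its entries in nonincreasing order, and let $\mathrm{gren}(w)$ be the vector of the $k+1$ slopes, over $[x-1,x]$, $x=0,\dots,k$, of the least concave majorant of the points $\bigl(j,\sum_{i=0}^j w_i\bigr)$, $j=-1,0,\dots,k$ (the empty sum being $0$). Let $\widehat p_{n,x}=n^{-1}\#\{i\le n: X_i=x\}$ be the empirical estimator, and let $\widehat p_n^R$ and $\widehat p_n^G$ be the rearrangement and Grenander estimators, obtained by applying $\mathrm{rear}$ and $\mathrm{gren}$ to $(\widehat p_{n,0},\dots,\widehat p_{n,M_n})$, $M_n=\max\{X_1,\dots,X_n\}$, and extending by zero. Put $Y_{n,x}=\sqrt n(\widehat p_{n,x}-p_x)$, $Y^R_{n,x}=\sqrt n(\widehat p^R_{n,x}-p_x)$, $Y^G_{n,x}=\sqrt n(\widehat p^G_{n,x}-p_x)$. Let $Y$ be a Gaussian random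 element of $\ell_2$ with mean zero and covariances $E[Y_xY_z]=p_x\delta_{x,z}-p_xp_z$. For a sequence $q$ write $q^{(r,s)}=(q_r,\dots,q_s)$. Suppose that $r\le s$ in $\mathbb N$ satisfy $p_{r-1}>p_r>\dots>p_s>p_{s+1}$ (where the condition $p_{r-1}>p_r$ is void if $r=0$). Then, as $n\to\infty$, $$Y_n^{(r,s)}\to_d Y^{(r,s)},\qquad (Y_n^R)^{(r,s)}\to_d Y^{(r,s)},\qquad (Y_n^G)^{(r,s)}\to_d Y^{(r,s)}\qquad\text{in }\mathbb R^{s-r+1},$$ and $\sqrt n\,(\widehat p^G_{n,x}-\widehat p_{n,x})\to 0$ in probability for every $x\in\{r,\dots,s\}$. -/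

import Mathlib

open MeasureTheory ProbabilityTheory Filter
open scoped Topology

noncomputable section

namespace DiscreteMonotone

/-- `rear w`: the entries of the vector `w`, listed in nonincreasing order. -/
def rear {k : ℕ} (w : Fin (k + 1) → ℝ) : Fin (k + 1) → ℝ :=
  fun i => w (Tuple.sort (fun j => -w j) i)

/-- Value at `t` of the least concave majorant, on the set `D`, of a set `Q` of points of the
plane: the infimum at `t` of all functions that are concave on `D` and lie above every point
of `Q`. -/
def leastConcaveMajorant (D : Set ℝ) (Q : Set (ℝ × ℝ)) (t : ℝ) : ℝ :=
  sInf {v : ℝ | ∃ g : ℝ → ℝ, ConcaveOn ℝ D g ∧ (∀ q ∈ Q, q.2 ≤ g q.1) ∧ v = g t}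

/-- The points `(j, w 0 + ⋯ + w j)` for `j = -1, 0, …, k` (the empty sum being `0`). -/
def cumulativePoints {k : ℕ} (w : Fin (k + 1) → ℝ) : Set (ℝ × ℝ) :=
  {q | ∃ m : ℕ, m ≤ k + 1 ∧
    q = ((m : ℝ) - 1, ∑ i : Fin (k + 1), if (i : ℕ) < m then w i else 0)}

/-- `gren w`: the slopes, on the unit intervals `[i - 1, i]` with `i = 0, …, k`, of the least
concave majorant of the cumulative points of the vector `w`. -/
def gren {k : ℕ} (w : Fin (k + 1) → ℝ) : Fin (k + 1) → ℝ :=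
  fun i =>
    leastConcaveMajorant (Set.Icc (-1) (k : ℝ)) (cumulativePoints w) (i : ℕ) -
      leastConcaveMajorant (Set.Icc (-1) (k : ℝ)) (cumulativePoints w) (((i : ℕ) : ℝ) - 1)

/-- Applies an operator on vectors to the initial part `(w 0, …, w M)` of a sequence, and extends
the result by zero. -/
def applyUpTo (φ : ∀ {k : ℕ}, (Fin (k + 1) → ℝ) → Fin (k + 1) → ℝ) (M : ℕ) (w : ℕ → ℝ) :
    ℕ → ℝ :=
  fun x => if h : x < M + 1 then φ (fun i : Fin (M + 1) => w i) ⟨x, h⟩ else 0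

variable {Ω : Type*}

/-- The empirical estimator from the first `n` observations `X 0, …, X (n - 1)`:
the proportion of the observations that are equal to `x`. -/
def empirical (X : ℕ → Ω → ℕ) (n : ℕ) (ω : Ω) : ℕ → ℝ :=
  fun x => (n : ℝ)⁻¹ * ∑ i ∈ Finset.range n, if X i ω = x then 1 else 0

/-- The largest of the first `n` observations. -/
def sampleMax (X : ℕ → Ω → ℕ) (n : ℕ) (ω : Ω) : ℕ :=
  (Finset.range n).sup fun i => X i ω

/-- The rearrangement estimator: the empirical proportions in nonincreasing order. -/
def rearrangementEstimator (X : ℕ → Ω → ℕ) (n : ℕ) (ω : Ω) : ℕ → ℝ :=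
  applyUpTo rear (sampleMax X n ω) (empirical X n ω)

/-- The Grenander estimator, that is, the maximum likelihood estimator among nonincreasing
mass functions: the slopes of the least concave majorant of the empirical distribution function. -/
def grenanderEstimator (X : ℕ → Ω → ℕ) (n : ℕ) (ω : Ω) : ℕ → ℝ :=
  applyUpTo gren (sampleMax X n ω) (empirical X n ω)

/-- The fluctuation `√n (q - p)` of an estimate `q` of `p` from `n` observations. -/
def fluctuation (n : ℕ) (q p : ℕ → ℝ) : ℕ → ℝ :=
  fun x => √(n : ℝ) * (q x - p x)

/-- The part `(q r, …, q s)` of a sequence `q`. -/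
def segment (r s : ℕ) (q : ℕ → ℝ) : Finset.Icc r s → ℝ :=
  fun x => q x

/-- The Hilbert space of square summable real sequences. -/
abbrev Ell2 : Type := lp (fun _ : ℕ => ℝ) 2

instance instMeasurableSpaceEll2 : MeasurableSpace Ell2 := borel Ell2

instance instBorelSpaceEll2 : BorelSpace Ell2 := ⟨rfl⟩

/-- `Y` is a Gaussian random element of `ℓ²` with mean zero and covariance operator `S` given by
`⟪S e_x, e_z⟫ = p x * δ_{x,z} - p x * p z`; here `⟪S e_x, e_z⟫` is the covariance of the
coordinates `Y_x = ⟪Y, e_x⟫` and `Y_z = ⟪Y, e_z⟫`. -/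
structure IsLimitProcess (p : ℕ → ℝ) {Ω' : Type*} [MeasurableSpace Ω'] (P' : Measure Ω')
    (Y : Ω' → Ell2) : Prop where
  gaussian : HasGaussianLaw Y P'
  mean_zero : ∫ ω, Y ω ∂P' = 0
  covariance : ∀ x z : ℕ,
    cov[fun ω => Y ω x, fun ω => Y ω z; P'] = (if x = z then p x else 0) - p x * p z

end DiscreteMonotone

end

/-! A strict drop of `p` after position `x` is inherited by the sample. Almost surely, for all large
`n`, some level separates the empirical entries up to `x` from all later ones
(`eventually_separatedAt_succ`). If a vector is separated just before and just after `x`, sorting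
keeps entry `x` in place (`rear_eq_of_separatedAt`), and the concave majorant touches the cumulative
sums at both ends of `[x - 1, x]` (`gren_eq_of_separatedAt`). So on `{r, …, s}` both estimators
eventually coincide exactly with the empirical one, and no factor `√n` can matter.

What remains is the central limit theorem for the empirical frequencies, obtained from the scalar
one by Cramér–Wold and passed to the other two estimators by Slutsky. -/

namespace DiscreteMonotone

/-! ### Deterministic facts on the rearrangement and on the Grenander operator -/

/-- The least concave majorant touches a point through which some line dominates all points. -/
lemma leastConcaveMajorant_eq_of_line {D : Set ℝ} (hD : Convex ℝ D) {Q : Set (ℝ × ℝ)} {t v c : ℝ}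
    (hmem : (t, v) ∈ Q) (hline : ∀ q ∈ Q, q.2 ≤ v + c * (q.1 - t)) :
    leastConcaveMajorant D Q t = v := by
  refine IsLeast.csInf_eq ⟨⟨fun y => v + c * (y - t), ?_, hline, by simp⟩, ?_⟩
  · refine ⟨hD, fun x _ y _ a b _ _ hab => le_of_eq ?_⟩
    simp only [smul_eq_mul]
    linear_combination (v - c * t) * hab
  · rintro _ ⟨g, -, hg, rfl⟩
    exact hg _ hmem

/-- The value `c` separates the entries of `q` before position `m` from those after it. -/
def SeparatedAt (q : ℕ → ℝ) (m : ℕ) (c : ℝ) : Prop :=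
  (∀ i < m, c ≤ q i) ∧ ∀ i, m ≤ i → q i ≤ c

lemma sum_fin_ite_lt_const {k m : ℕ} (hm : m ≤ k + 1) (c : ℝ) :
    (∑ i : Fin (k + 1), if (i : ℕ) < m then c else 0) = m * c := by
  rw [Fin.sum_univ_eq_sum_range (fun i => if i < m then c else 0) (k + 1), ← Finset.sum_filter,
    Finset.sum_const, nsmul_eq_mul]
  congr 2
  have : Finset.filter (fun i => i < m) (Finset.range (k + 1)) = Finset.range m := by
    ext i; simp; omega
  rw [this, Finset.card_range]

/-- The increments `q i - c` are nonnegative before `m` and nonpositive afterwards, so their partial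
sums peak at `m`: the line of slope `c` through that cumulative point dominates all the others. -/
lemma leastConcaveMajorant_cumulativePoints_of_separatedAt {k m : ℕ} {q : ℕ → ℝ} {c : ℝ}
    (hm : m ≤ k + 1) (hq : SeparatedAt q m c) :
    leastConcaveMajorant (Set.Icc (-1) (k : ℝ)) (cumulativePoints fun i : Fin (k + 1) => q i)
        ((m : ℝ) - 1) =
      ∑ i : Fin (k + 1), if (i : ℕ) < m then q i else 0 := by
  refine leastConcaveMajorant_eq_of_line (c := c) (convex_Icc _ _) ⟨m, hm, rfl⟩ ?_
  rintro _ ⟨l, hl, rfl⟩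
  have key : (∑ i : Fin (k + 1), if (i : ℕ) < l then q i - c else 0) ≤
      ∑ i : Fin (k + 1), if (i : ℕ) < m then q i - c else 0 := by
    refine Finset.sum_le_sum fun i _ => ?_
    by_cases h1 : (i : ℕ) < m
    · have := hq.1 i h1
      split_ifs <;> linarith
    · have := hq.2 i (not_lt.1 h1)
      split_ifs <;> linarith
  have split (j : ℕ) (hj : j ≤ k + 1) : (∑ i : Fin (k + 1), if (i : ℕ) < j then q i - c else 0) =
      (∑ i : Fin (k + 1), if (i : ℕ) < j then q i else 0) - j * c := by
    rw [← sum_fin_ite_lt_const hj c, ← Finset.sum_sub_distrib]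
    exact Finset.sum_congr rfl fun i _ => by split_ifs <;> simp
  rw [split l hl, split m hm] at key
  simp only
  linarith

lemma gren_eq_of_separatedAt {k : ℕ} {q : ℕ → ℝ} {c d : ℝ} (x : Fin (k + 1))
    (hc : SeparatedAt q x c) (hd : SeparatedAt q (x + 1) d) :
    gren (fun i : Fin (k + 1) => q i) x = q x := by
  have h1 := leastConcaveMajorant_cumulativePoints_of_separatedAt x.2.le hc
  have h2 := leastConcaveMajorant_cumulativePoints_of_separatedAt (k := k) x.2 hd
  push_cast at h2
  rw [add_sub_cancel_right] at h2
  rw [gren, h1, h2, ← Finset.sum_sub_distrib, Finset.sum_eq_single x]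
  · simp
  · intro i _ hi
    have : (i : ℕ) ≠ x := fun h => hi (Fin.ext h)
    split_ifs <;> first | omega | simp
  · simp

/-- A counting argument, valid with ties: at most `x` entries exceed `q x`, and at least `x + 1`
entries are `≥ q x`. Sorting preserves both counts. -/
lemma rear_eq_of_separatedAt {k : ℕ} {q : ℕ → ℝ} {c d : ℝ} (x : Fin (k + 1))
    (hc : SeparatedAt q x c) (hd : SeparatedAt q (x + 1) d) :
    rear (fun i : Fin (k + 1) => q i) x = q x := by
  set w : Fin (k + 1) → ℝ := fun i => q i
  set σ := Tuple.sort fun j => -w j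
  have hanti : Antitone (w ∘ σ) := fun i j hij => by
    have := Tuple.monotone_sort (fun j => -w j) hij
    simpa using this
  have hcard (s : Fin (k + 1) → Prop) [DecidablePred s] :
      (Finset.univ.filter fun i => s (σ i)).card = (Finset.univ.filter s).card :=
    Finset.card_equiv σ (by simp)
  refine le_antisymm (not_lt.1 fun hlt => ?_) ?_
  · have h := (Tuple.lt_card_gt_iff_apply_gt_of_antitone (j := x) (f := w ∘ σ) (a := w x) hanti).2 hlt
    have h2 : (Finset.univ.filter fun i => w x < w i) ⊆ Finset.Iio x := by
      intro i hi
      simp only [Finset.mem_filter, Finset.mem_univ, true_and, Finset.mem_Iio] at hi ⊢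
      by_contra hix
      have hxi : (x : ℕ) ≤ i := not_lt.1 hix
      rcases hxi.eq_or_lt with h | h
      · exact hi.ne (congrArg q h)
      · exact absurd (hd.2 i h) (not_le.2 ((hd.1 x (by omega)).trans_lt hi))
    have h3 := Finset.card_le_card h2
    rw [Fin.card_Iio] at h3
    have h4 := hcard fun i => w x < w i
    simp only [Function.comp_apply] at h h4
    omega
  · refine (Tuple.lt_card_ge_iff_apply_ge_of_antitone (j := x) (f := w ∘ σ) (a := w x) hanti).1 ?_
    have h2 : Finset.Iic x ⊆ (Finset.univ.filter fun i => w x ≤ w i) := by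
      intro i hi
      simp only [Finset.mem_filter, Finset.mem_univ, true_and, Finset.mem_Iic] at hi ⊢
      rcases hi.eq_or_lt with h | h
      · rw [h]
      · exact (hc.2 x le_rfl).trans (hc.1 i h)
    have h3 := Finset.card_le_card h2
    rw [Fin.card_Iic] at h3
    have h4 := hcard fun i => w x ≤ w i
    simp only [Function.comp_apply] at h4 ⊢
    omega

/-- Pointwise convergence controls only finitely many entries. The tail is controlled by mass: once
the first `N` entries sum to more than `1 - c`, no later entry can reach `c`. -/
lemma eventually_separatedAt_succ {p : ℕ → ℝ} (hp_nonneg : ∀ x, 0 ≤ p x) (hp_sum : HasSum p 1)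
    (hp_anti : Antitone p) {q : ℕ → ℕ → ℝ} (hq_sum : ∀ n (F : Finset ℕ), ∑ i ∈ F, q n i ≤ 1)
    (hq : ∀ i, Tendsto (fun n => q n i) atTop (𝓝 (p i))) {x : ℕ} (hx : p (x + 1) < p x) :
    ∃ c > 0, ∀ᶠ n in atTop, SeparatedAt (q n) (x + 1) c := by
  obtain ⟨c, hc1, hc2⟩ := exists_between hx
  have hc0 : 0 < c := (hp_nonneg _).trans_lt hc1
  obtain ⟨N, hN⟩ := ((hp_sum.tendsto_sum_nat).eventually_const_lt
    (show 1 - c < 1 by linarith)).exists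
  have h1 : ∀ᶠ n in atTop, 1 - c < ∑ i ∈ Finset.range N, q n i :=
    (tendsto_finsetSum _ fun i _ => hq i).eventually_const_lt hN
  have h2 : ∀ᶠ n in atTop, ∀ i ∈ Finset.range (x + 1), c < q n i := by
    refine (Finset.eventually_all _).2 fun i hi => (hq i).eventually_const_lt (hc2.trans_le ?_)
    exact hp_anti (by simpa [Nat.lt_succ_iff] using hi)
  have h3 : ∀ᶠ n in atTop, ∀ i ∈ Finset.Ico (x + 1) N, q n i < c := by
    refine (Finset.eventually_all _).2 fun i hi => (hq i).eventually_lt_const (lt_of_le_of_lt ?_ hc1)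
    exact hp_anti (Finset.mem_Ico.1 hi).1
  refine ⟨c, hc0, ?_⟩
  filter_upwards [h1, h2, h3] with n h1 h2 h3
  refine ⟨fun i hi => (h2 i (by simpa using hi)).le, fun i hi => ?_⟩
  rcases lt_or_ge i N with hiN | hiN
  · exact (h3 i (Finset.mem_Ico.2 ⟨hi, hiN⟩)).le
  · have h := hq_sum n (insert i (Finset.range N))
    rw [Finset.sum_insert (by simpa using hiN)] at h
    linarith

/-! ### The estimators at a fixed sample -/

section Estimators

variable {Ω : Type*}

lemma sum_empirical_le_one (X : ℕ → Ω → ℕ) (n : ℕ) (ω : Ω) (F : Finset ℕ) :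
    ∑ x ∈ F, empirical X n ω x ≤ 1 := by
  simp only [empirical]
  rw [← Finset.mul_sum, Finset.sum_comm]
  have h : (∑ i ∈ Finset.range n, ∑ x ∈ F, if X i ω = x then (1 : ℝ) else 0) ≤ n := by
    calc _ ≤ ∑ i ∈ Finset.range n, (1 : ℝ) := by
          refine Finset.sum_le_sum fun i _ => ?_
          rw [Finset.sum_ite_eq]
          split_ifs <;> simp
      _ = n := by simp
  calc _ ≤ (n : ℝ)⁻¹ * n := by gcongr
    _ ≤ 1 := inv_mul_le_one

lemma empirical_le_one (X : ℕ → Ω → ℕ) (n : ℕ) (ω : Ω) (x : ℕ) : empirical X n ω x ≤ 1 := by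
  simpa using sum_empirical_le_one X n ω {x}

lemma le_sampleMax_of_empirical_pos {X : ℕ → Ω → ℕ} {n : ℕ} {ω : Ω} {x : ℕ}
    (h : 0 < empirical X n ω x) : x ≤ sampleMax X n ω := by
  have h2 := (pos_iff_pos_of_mul_pos h).1
  obtain ⟨i, hi, hne⟩ : ∃ i ∈ Finset.range n, (if X i ω = x then (1 : ℝ) else 0) ≠ 0 :=
    Finset.exists_ne_zero_of_sum_ne_zero (right_ne_zero_of_mul h.ne')
  have : X i ω = x := by by_contra h'; simp [h'] at hne
  exact this ▸ Finset.le_sup (f := fun i => X i ω) hi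

lemma estimators_eq_of_separatedAt {X : ℕ → Ω → ℕ} {n : ℕ} {ω : Ω} {x : ℕ} {c d : ℝ} (hd0 : 0 < d)
    (hc : SeparatedAt (empirical X n ω) x c) (hd : SeparatedAt (empirical X n ω) (x + 1) d) :
    rearrangementEstimator X n ω x = empirical X n ω x ∧
      grenanderEstimator X n ω x = empirical X n ω x := by
  -- Since `d > 0`, the value `x` has been observed, so it lies where the operators act and not in
  -- the extension by zero.
  have hx : x < sampleMax X n ω + 1 :=
    Nat.lt_succ_of_le (le_sampleMax_of_empirical_pos (hd0.trans_le (hd.1 x (by omega))))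
  simp only [rearrangementEstimator, grenanderEstimator, applyUpTo, dif_pos hx]
  exact ⟨rear_eq_of_separatedAt ⟨x, hx⟩ hc hd, gren_eq_of_separatedAt ⟨x, hx⟩ hc hd⟩

lemma eventually_estimators_eq {p : ℕ → ℝ} (hp_nonneg : ∀ x, 0 ≤ p x) (hp_sum : HasSum p 1)
    (hp_anti : Antitone p) {X : ℕ → Ω → ℕ} {ω : Ω}
    (hω : ∀ x, Tendsto (fun n => empirical X n ω x) atTop (𝓝 (p x)))
    {r s x : ℕ} (h_strict : ∀ x, r ≤ x + 1 → x ≤ s → p (x + 1) < p x) (hrx : r ≤ x) (hxs : x ≤ s) :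
    ∀ᶠ n in atTop, rearrangementEstimator X n ω x = empirical X n ω x ∧
      grenanderEstimator X n ω x = empirical X n ω x := by
  have hsucc (y : ℕ) (hy : p (y + 1) < p y) :=
    eventually_separatedAt_succ hp_nonneg hp_sum hp_anti
      (fun n => sum_empirical_le_one X n ω) hω hy
  obtain ⟨d, hd0, hd⟩ := hsucc x (h_strict x (by omega) hxs)
  obtain ⟨c, hc⟩ : ∃ c, ∀ᶠ n in atTop, SeparatedAt (empirical X n ω) x c := by
    cases x with
    -- No entry precedes position `0`, so any upper bound of the frequencies serves as level.
    | zero => exact ⟨1, .of_forall fun n => ⟨by simp, fun i _ => empirical_le_one X n ω i⟩⟩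
    | succ y =>
      obtain ⟨c, -, hc⟩ := hsucc y (h_strict y hrx (by omega))
      exact ⟨c, hc⟩
  filter_upwards [hc, hd] with n hc hd using estimators_eq_of_separatedAt hd0 hc hd

/-! ### Measurability -/

/-- A function of finitely many discrete random variables is measurable. -/
lemma measurable_of_eq_of_agree [MeasurableSpace Ω] {E : Type*} [MeasurableSpace E]
    {X : ℕ → Ω → ℕ} (hX : ∀ i, Measurable (X i)) (n : ℕ) {g : Ω → E} {G : (ℕ → ℕ) → E}
    (hgG : ∀ ω, g ω = G fun i => X i ω)
    (hG : ∀ z z' : ℕ → ℕ, (∀ i < n, z i = z' i) → G z = G z') : Measurable g := by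
  -- `g` factors through the countable discrete space `Fin n → ℕ`, where every map is measurable; no
  -- regularity of `G` is needed.
  have : g = (fun y : Fin n → ℕ => G fun i => if h : i < n then y ⟨i, h⟩ else 0) ∘
      fun ω (i : Fin n) => X i ω := by
    ext1 ω
    rw [hgG]
    exact hG _ _ fun i hi => by simp [hi]
  rw [this]
  exact (measurable_of_countable _).comp (measurable_pi_lambda _ fun i => hX i)

lemma empirical_congr {z z' : ℕ → ℕ} {n : ℕ} (h : ∀ i < n, z i = z' i) :
    empirical (fun i (z : ℕ → ℕ) => z i) n z = empirical (fun i z => z i) n z' := by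
  ext x
  simp only [empirical]
  congr 1
  exact Finset.sum_congr rfl fun i hi => by simp only [h i (Finset.mem_range.1 hi)]

lemma sampleMax_congr {z z' : ℕ → ℕ} {n : ℕ} (h : ∀ i < n, z i = z' i) :
    sampleMax (fun i (z : ℕ → ℕ) => z i) n z = sampleMax (fun i z => z i) n z' :=
  Finset.sup_congr rfl fun i hi => h i (Finset.mem_range.1 hi)

lemma measurable_empirical [MeasurableSpace Ω] {X : ℕ → Ω → ℕ} (hX : ∀ i, Measurable (X i))
    (n : ℕ) : Measurable (empirical X n) :=
  measurable_of_eq_of_agree hX n (G := empirical (fun i z => z i) n) (fun _ => rfl)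
    fun _ _ => empirical_congr

lemma measurable_rearrangementEstimator [MeasurableSpace Ω] {X : ℕ → Ω → ℕ}
    (hX : ∀ i, Measurable (X i)) (n : ℕ) : Measurable (rearrangementEstimator X n) :=
  measurable_of_eq_of_agree hX n (G := rearrangementEstimator (fun i z => z i) n) (fun _ => rfl)
    fun z z' h => by rw [rearrangementEstimator, rearrangementEstimator, empirical_congr h,
      sampleMax_congr h]

lemma measurable_grenanderEstimator [MeasurableSpace Ω] {X : ℕ → Ω → ℕ}
    (hX : ∀ i, Measurable (X i)) (n : ℕ) : Measurable (grenanderEstimator X n) :=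
  measurable_of_eq_of_agree hX n (G := grenanderEstimator (fun i z => z i) n) (fun _ => rfl)
    fun z z' h => by rw [grenanderEstimator, grenanderEstimator, empirical_congr h,
      sampleMax_congr h]

lemma measurable_segment_fluctuation [MeasurableSpace Ω] (r s n : ℕ) (p : ℕ → ℝ)
    {q : Ω → ℕ → ℝ} (hq : Measurable q) :
    Measurable fun ω => segment r s (fluctuation n (q ω) p) := by
  refine measurable_pi_lambda _ fun x => ?_
  exact (((measurable_pi_apply (x : ℕ)).comp hq).sub_const _).const_mul _

end Estimators

/-! ### The central limit theorem for the empirical estimator -/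

lemma charFun_map_toLp {ι Ω : Type*} [Fintype ι] [MeasurableSpace Ω] {P : Measure Ω}
    {W : Ω → ι → ℝ} (hW : AEMeasurable W P) (t : EuclideanSpace ℝ ι) :
    charFun (P.map fun ω => (WithLp.toLp 2 (W ω) : EuclideanSpace ℝ ι)) t =
      charFun (P.map fun ω => ∑ i, t i * W ω i) 1 := by
  have hW' : AEMeasurable (fun ω => (WithLp.toLp 2 (W ω) : EuclideanSpace ℝ ι)) P :=
    (WithLp.measurable_toLp 2 _).comp_aemeasurable hW
  have hs : AEMeasurable (fun ω => ∑ i, t i * W ω i) P := by fun_prop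
  rw [charFun_apply, charFun_apply, integral_map hW' (by fun_prop), integral_map hs (by fun_prop)]
  simp [PiLp.inner_apply]

/-- The **Cramér–Wold device**. -/
lemma tendstoInDistribution_pi_of_forall_sum {ι Ω Ω' : Type*} [Fintype ι] [MeasurableSpace Ω]
    [MeasurableSpace Ω'] {P : Measure Ω} [IsProbabilityMeasure P] {P' : Measure Ω'}
    [IsProbabilityMeasure P'] {Z : ℕ → Ω → ι → ℝ} {Y : Ω' → ι → ℝ}
    (hZ : ∀ n, AEMeasurable (Z n) P) (hY : AEMeasurable Y P')
    (h : ∀ t : ι → ℝ, TendstoInDistribution (fun n ω => ∑ i, t i * Z n ω i) atTop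
      (fun ω => ∑ i, t i * Y ω i) (fun _ => P) P') :
    TendstoInDistribution Z atTop Y (fun _ => P) P' := by
  have hm : Measurable (WithLp.toLp 2 : (ι → ℝ) → EuclideanSpace ℝ ι) :=
    WithLp.measurable_toLp 2 _
  have key : TendstoInDistribution (fun n ω => (WithLp.toLp 2 (Z n ω) : EuclideanSpace ℝ ι)) atTop
      (fun ω => WithLp.toLp 2 (Y ω)) (fun _ => P) P' :=
    { forall_aemeasurable := fun n => hm.comp_aemeasurable (hZ n)
      aemeasurable_limit := hm.comp_aemeasurable hY
      tendsto := by
        refine ProbabilityMeasure.tendsto_iff_tendsto_charFun.2 fun t => ?_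
        -- The vector characteristic function at `t` is that of the projection along `t` at `1`.
        have h1 := ProbabilityMeasure.tendsto_iff_tendsto_charFun.1 (h t).tendsto 1
        simp only [ProbabilityMeasure.coe_mk] at h1 ⊢
        rw [charFun_map_toLp hY]
        simp_rw [charFun_map_toLp (hZ _)]
        exact h1 }
  exact key.continuous_comp (g := WithLp.ofLp) (PiLp.continuous_ofLp 2 _)

/-- Puts a projection of the fluctuations into the form of the scalar central limit theorem: a
normalised, centred sum of one function of each observation. -/
lemma sum_mul_fluctuation_empirical {ι Ω : Type*} [Fintype ι] {p : ℕ → ℝ}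
    {X : ℕ → Ω → ℕ} (f : ι → ℕ) (t : ι → ℝ) (n : ℕ)
    (ω : Ω) :
    ∑ j, t j * fluctuation n (empirical X n ω) p (f j) =
      (√n)⁻¹ * (∑ i ∈ Finset.range n, (∑ j, t j * if X i ω = f j then 1 else 0) -
        n * ∑ j, t j * p (f j)) := by
  rw [Finset.sum_comm, Finset.mul_sum, ← Finset.sum_sub_distrib, Finset.mul_sum]
  refine Finset.sum_congr rfl fun j _ => ?_
  rw [← Finset.mul_sum, fluctuation, empirical]
  rcases Nat.eq_zero_or_pos n with rfl | hn
  · simp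
  · have hn' : (0 : ℝ) < n := by exact_mod_cast hn
    have hs : √(n : ℝ) * √(n : ℝ) = n := Real.mul_self_sqrt hn'.le
    have hs0 : √(n : ℝ) ≠ 0 := (Real.sqrt_pos.2 hn').ne'
    field_simp
    rw [Real.sq_sqrt hn'.le]

lemma integral_indicator_eq {Ω : Type*} [MeasurableSpace Ω] {P : Measure Ω} {p : ℕ → ℝ}
    {X : ℕ → Ω → ℕ} (hX_meas : ∀ i, Measurable (X i))
    (hX_law : ∀ i x, P.real (X i ⁻¹' {x}) = p x) (i x : ℕ) :
    ∫ ω, (if X i ω = x then (1 : ℝ) else 0) ∂P = p x := by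
  rw [← hX_law i x, ← integral_indicator_one (hX_meas i (by simp))]
  refine integral_congr_ae (.of_forall fun ω => ?_)
  by_cases h : X i ω = x <;> simp [h]

section Sample

variable {Ω Ω' : Type*} [MeasurableSpace Ω] {P : Measure Ω} [IsProbabilityMeasure P]
  [MeasurableSpace Ω'] {P' : Measure Ω'} [IsProbabilityMeasure P'] {p : ℕ → ℝ} {X : ℕ → Ω → ℕ}

lemma identDistrib_of_measureReal_preimage_singleton (hX_meas : ∀ i, Measurable (X i))
    (hX_law : ∀ i x, P.real (X i ⁻¹' {x}) = p x) (i : ℕ) : IdentDistrib (X i) (X 0) P P where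
  aemeasurable_fst := (hX_meas i).aemeasurable
  aemeasurable_snd := (hX_meas 0).aemeasurable
  map_eq := by
    refine Measure.ext_of_singleton fun x => ?_
    rw [Measure.map_apply (hX_meas i) (by simp), Measure.map_apply (hX_meas 0) (by simp)]
    exact (measureReal_eq_measureReal_iff (by simp) (by simp)).1
      ((hX_law i x).trans (hX_law 0 x).symm)

lemma memLp_indicator_eq (hX_meas : ∀ i, Measurable (X i)) (i x : ℕ) :
    MemLp (fun ω => if X i ω = x then (1 : ℝ) else 0) 2 P := by
  have hm : Measurable fun y : ℕ => if y = x then (1 : ℝ) else 0 := measurable_of_countable _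
  refine MemLp.of_bound (hm.comp (hX_meas i)).aestronglyMeasurable 1 (.of_forall fun ω => ?_)
  split_ifs <;> simp

lemma covariance_indicator_eq (hX_meas : ∀ i, Measurable (X i))
    (hX_law : ∀ i x, P.real (X i ⁻¹' {x}) = p x) (i x z : ℕ) :
    cov[fun ω => if X i ω = x then (1 : ℝ) else 0, fun ω => if X i ω = z then (1 : ℝ) else 0; P] =
      (if x = z then p x else 0) - p x * p z := by
  rw [covariance_eq_sub (memLp_indicator_eq hX_meas i x) (memLp_indicator_eq hX_meas i z),
    integral_indicator_eq hX_meas hX_law, integral_indicator_eq hX_meas hX_law]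
  congr 1
  split_ifs with h
  · rw [← integral_indicator_eq hX_meas hX_law i x]
    refine integral_congr_ae (.of_forall fun ω => ?_)
    simp [h]
  · rw [← integral_zero Ω ℝ (μ := P)]
    refine integral_congr_ae (.of_forall fun ω => ?_)
    by_cases hx : X i ω = x
    · have : X i ω ≠ z := fun hz => h (hx.symm.trans hz)
      simp [this]
    · simp [hx]

lemma ae_tendsto_empirical (hX_meas : ∀ i, Measurable (X i)) (hX_indep : iIndepFun X P)
    (hX_law : ∀ i x, P.real (X i ⁻¹' {x}) = p x) :
    ∀ᵐ ω ∂P, ∀ x, Tendsto (fun n => empirical X n ω x) atTop (𝓝 (p x)) := by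
  refine ae_all_iff.2 fun x => ?_
  have hm : Measurable fun y : ℕ => if y = x then (1 : ℝ) else 0 := measurable_of_countable _
  have h := strong_law_ae (μ := P) (fun i ω => if X i ω = x then (1 : ℝ) else 0)
    ((memLp_indicator_eq hX_meas 0 x).integrable (by simp))
    (fun i j hij => (hX_indep.indepFun hij).comp hm hm)
    (fun i => (identDistrib_of_measureReal_preimage_singleton hX_meas hX_law i).comp hm)
  rw [integral_indicator_eq hX_meas hX_law] at h
  exact h

/-- The unit vectors span a dense subspace. This is used for the integrability of the Gaussian
element `Y`, so that its mean commutes with continuous functionals. -/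
lemma secondCountableTopology_ell2 : SecondCountableTopology Ell2 := by
  have hsep : TopologicalSpace.IsSeparable
      (Submodule.span ℝ (Set.range fun i : ℕ => lp.single (E := fun _ : ℕ => ℝ) 2 i 1) : Set Ell2) :=
    (Set.countable_range _).isSeparable.span
  have : TopologicalSpace.SeparableSpace Ell2 := by
    refine TopologicalSpace.isSeparable_univ_iff.1 (hsep.closure.mono fun f _ => ?_)
    refine mem_closure_of_tendsto (lp.hasSum_single (by simp) f)
      (.of_forall fun F => Submodule.sum_mem _ fun i _ => ?_)
    have h : lp.single (E := fun _ : ℕ => ℝ) 2 i (f i) =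
        f i • lp.single (E := fun _ : ℕ => ℝ) 2 i 1 := by
      rw [← lp.single_smul, smul_eq_mul, mul_one]
    rw [h]
    exact Submodule.smul_mem _ _ (Submodule.subset_span ⟨i, rfl⟩)
  exact UniformSpace.secondCountable_of_separable Ell2

lemma hasLaw_sum_mul_limitProcess {Y : Ω' → Ell2} (hY : IsLimitProcess p P' Y) {ι : Type*}
    [Fintype ι] (f : ι → ℕ) (t : ι → ℝ) :
    HasLaw (fun ω => ∑ j, t j * Y ω (f j)) (gaussianReal 0
      (∑ i, ∑ j, t i * t j * ((if f i = f j then p (f i) else 0) - p (f i) * p (f j))).toNNReal)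
      P' := by
  -- As a continuous functional of `Y`, the combination is Gaussian, so its mean and variance
  -- determine its law.
  let L : Ell2 →L[ℝ] ℝ := ∑ j, t j • lp.evalCLM ℝ (fun _ : ℕ => ℝ) 2 (f j)
  have hL : (fun ω => ∑ j, t j * Y ω (f j)) = fun ω => L (Y ω) := by
    ext ω
    simp only [L, _root_.sum_apply, _root_.smul_apply, smul_eq_mul]
    rfl
  have hcoord (x : ℕ) : HasGaussianLaw (fun ω => Y ω x) P' :=
    hY.gaussian.map_fun (lp.evalCLM ℝ (fun _ : ℕ => ℝ) 2 x)
  have hG : HasGaussianLaw (fun ω => ∑ j, t j * Y ω (f j)) P' := hL ▸ hY.gaussian.map_fun L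
  refine ⟨hG.aemeasurable, ?_⟩
  rw [hG.map_eq_gaussianReal]
  congr 2
  · have := secondCountableTopology_ell2
    rw [hL, ContinuousLinearMap.integral_comp_comm L hY.gaussian.integrable, hY.mean_zero, map_zero]
  · rw [← covariance_self hG.aemeasurable, covariance_fun_sum_fun_sum]
    · simp only [covariance_const_mul_left, covariance_const_mul_right, hY.covariance, mul_assoc,
        mul_left_comm]
    · exact fun j => (hcoord _).memLp_two.const_mul _
    · exact fun j => (hcoord _).memLp_two.const_mul _

lemma tendstoInDistribution_segment_empirical (hX_meas : ∀ i, Measurable (X i))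
    (hX_indep : iIndepFun X P) (hX_law : ∀ i x, P.real (X i ⁻¹' {x}) = p x)
    {Y : Ω' → Ell2} (hY : IsLimitProcess p P' Y) (r s : ℕ) :
    TendstoInDistribution (fun n ω => segment r s (fluctuation n (empirical X n ω) p)) atTop
      (fun ω' => segment r s (Y ω')) (fun _ => P) P' := by
  have hcoord (x : ℕ) : HasGaussianLaw (fun ω => Y ω x) P' :=
    hY.gaussian.map_fun (lp.evalCLM ℝ (fun _ : ℕ => ℝ) 2 x)
  refine tendstoInDistribution_pi_of_forall_sum
    (fun n => (measurable_segment_fluctuation r s n p (measurable_empirical hX_meas n)).aemeasurable)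
    (aemeasurable_pi_lambda _ fun x => (hcoord x).aemeasurable) fun t => ?_
  -- The projection along `t` is the normalised sum of the i.i.d. variables `u (X i)`. Indicators of
  -- values have the same covariances as the coordinates of `Y`, so the limit variance is that of `u
  -- (X 0)`.
  let u : ℕ → ℝ := fun y => ∑ j : Finset.Icc r s, t j * if y = j then 1 else 0
  have hu : Measurable u := measurable_of_countable _
  have hmem (j : Finset.Icc r s) : MemLp (fun ω => t j * if X 0 ω = j then (1 : ℝ) else 0) 2 P :=
    (memLp_indicator_eq hX_meas 0 j).const_mul _
  have hL2 : MemLp (fun ω => u (X 0 ω)) 2 P := memLp_finsetSum _ fun j _ => hmem j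
  have hmean : ∫ ω, u (X 0 ω) ∂P = ∑ j, t j * p j := by
    simp only [u]
    rw [integral_finsetSum _ fun j _ => (hmem j).integrable (by simp)]
    simp_rw [integral_const_mul, integral_indicator_eq hX_meas hX_law]
  have hvar : Var[fun ω => u (X 0 ω); P] = ∑ i : Finset.Icc r s, ∑ j : Finset.Icc r s,
      t i * t j * ((if (i : ℕ) = j then p i else 0) - p i * p j) := by
    rw [← covariance_self hL2.aemeasurable, covariance_fun_sum_fun_sum hmem hmem]
    simp only [covariance_const_mul_left, covariance_const_mul_right,
      covariance_indicator_eq hX_meas hX_law, mul_assoc, mul_left_comm]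
  have hlaw := hasLaw_sum_mul_limitProcess hY (fun j : Finset.Icc r s => (j : ℕ)) t
  rw [← hvar] at hlaw
  have h := tendstoInDistribution_inv_sqrt_mul_sum_sub (X := fun i ω => u (X i ω)) hlaw hL2
    (hX_indep.comp (fun _ => u) fun _ => hu)
    (fun i => (identDistrib_of_measureReal_preimage_singleton hX_meas hX_law i).comp hu)
  rw [hmean] at h
  refine h.congr (fun n => .of_forall fun ω => ?_) .rfl
  exact (sum_mul_fluctuation_empirical (fun j : Finset.Icc r s => (j : ℕ)) t n _).symm

/-- Estimators that eventually agree with the empirical one on `{r, …, s}`, almost surely, have the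
same limit in distribution there. -/
lemma tendstoInDistribution_segment_of_eventually_eq {Z : Ω' → Finset.Icc r s → ℝ}
    {q q' : ℕ → Ω → ℕ → ℝ} (hq' : ∀ n, Measurable (q' n)) (hq : ∀ n, Measurable (q n))
    (h : TendstoInDistribution (fun n ω => segment r s (fluctuation n (q n ω) p)) atTop Z
      (fun _ => P) P')
    (heq : ∀ᵐ ω ∂P, ∀ x, r ≤ x → x ≤ s → ∀ᶠ n in atTop, q' n ω x = q n ω x) :
    TendstoInDistribution (fun n ω => segment r s (fluctuation n (q' n ω) p)) atTop Z
      (fun _ => P) P' := by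
  have hm := fun n => measurable_segment_fluctuation r s n p (hq n)
  have hm' := fun n => measurable_segment_fluctuation r s n p (hq' n)
  -- Slutsky: the difference is almost surely eventually zero, hence tends to zero in measure.
  refine tendstoInDistribution_of_tendstoInMeasure_sub _ _ h ?_ fun n => (hm' n).aemeasurable
  refine tendstoInMeasure_of_tendsto_ae
    (fun n => ((hm' n).sub (hm n)).aestronglyMeasurable) ?_
  filter_upwards [heq] with ω hω
  refine tendsto_pi_nhds.2 fun x => tendsto_const_nhds.congr' ?_
  filter_upwards [hω x (Finset.mem_Icc.1 x.2).1 (Finset.mem_Icc.1 x.2).2] with n hn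
  simp [segment, fluctuation, hn]

end Sample

end DiscreteMonotone

theorem mainTheorem7
    {Ω : Type*} [MeasurableSpace Ω] (P : Measure Ω) [IsProbabilityMeasure P]
    {Ω' : Type*} [MeasurableSpace Ω'] (P' : Measure Ω') [IsProbabilityMeasure P']
    (p : ℕ → ℝ) (hp_nonneg : ∀ x, 0 ≤ p x) (hp_sum : HasSum p 1) (hp_anti : Antitone p)
    (X : ℕ → Ω → ℕ) (hX_meas : ∀ i, Measurable (X i)) (hX_indep : iIndepFun X P)
    (hX_law : ∀ i x, P.real (X i ⁻¹' {x}) = p x)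
    (Y : Ω' → DiscreteMonotone.Ell2) (hY : DiscreteMonotone.IsLimitProcess p P' Y)
    (r s : ℕ) (hrs : r ≤ s)
    (h_strict : ∀ x, r ≤ x + 1 → x ≤ s → p (x + 1) < p x) :
    TendstoInDistribution
        (fun n ω => DiscreteMonotone.segment r s (DiscreteMonotone.fluctuation n
          (DiscreteMonotone.empirical X n ω) p))
        atTop (fun ω' => DiscreteMonotone.segment r s (Y ω')) (fun _ => P) P' ∧
      TendstoInDistribution
        (fun n ω => DiscreteMonotone.segment r s (DiscreteMonotone.fluctuation n
          (DiscreteMonotone.rearrangementEstimator X n ω) p))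
        atTop (fun ω' => DiscreteMonotone.segment r s (Y ω')) (fun _ => P) P' ∧
      TendstoInDistribution
        (fun n ω => DiscreteMonotone.segment r s (DiscreteMonotone.fluctuation n
          (DiscreteMonotone.grenanderEstimator X n ω) p))
        atTop (fun ω' => DiscreteMonotone.segment r s (Y ω')) (fun _ => P) P' ∧
      ∀ x, r ≤ x → x ≤ s →
        TendstoInMeasure P
          (fun (n : ℕ) ω => √(n : ℝ) *
            (DiscreteMonotone.grenanderEstimator X n ω x - DiscreteMonotone.empirical X n ω x))
          atTop (fun _ => 0) := by
  have hae : ∀ᵐ ω ∂P, ∀ x, r ≤ x → x ≤ s → ∀ᶠ n in atTop,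
      DiscreteMonotone.rearrangementEstimator X n ω x = DiscreteMonotone.empirical X n ω x ∧
        DiscreteMonotone.grenanderEstimator X n ω x = DiscreteMonotone.empirical X n ω x := by
    filter_upwards [DiscreteMonotone.ae_tendsto_empirical hX_meas hX_indep hX_law] with ω hω x hrx
      hxs using DiscreteMonotone.eventually_estimators_eq hp_nonneg hp_sum hp_anti hω h_strict hrx hxs
  have hE := DiscreteMonotone.measurable_empirical hX_meas
  have hR := DiscreteMonotone.measurable_rearrangementEstimator hX_meas
  have hG := DiscreteMonotone.measurable_grenanderEstimator hX_meas
  have hclt := DiscreteMonotone.tendstoInDistribution_segment_empirical hX_meas hX_indep hX_law hY r s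
  refine ⟨hclt, ?_, ?_, fun x hrx hxs => ?_⟩
  · refine DiscreteMonotone.tendstoInDistribution_segment_of_eventually_eq hR hE hclt ?_
    filter_upwards [hae] with ω hω x hrx hxs using (hω x hrx hxs).mono fun _ h => h.1
  · refine DiscreteMonotone.tendstoInDistribution_segment_of_eventually_eq hG hE hclt ?_
    filter_upwards [hae] with ω hω x hrx hxs using (hω x hrx hxs).mono fun _ h => h.2
  · refine tendstoInMeasure_of_tendsto_ae (fun n => Measurable.aestronglyMeasurable ?_) ?_
    · exact (((measurable_pi_apply x).comp (hG n)).sub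
        ((measurable_pi_apply x).comp (hE n))).const_mul _
    · filter_upwards [hae] with ω hω
      -- The difference is exactly zero for large `n`, which absorbs the factor `√n`.
      refine tendsto_const_nhds.congr' ?_
      filter_upwards [hω x hrx hxs] with n hn
      simp [hn.2]
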